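/- For $r>0$ and $X\subset\mathbb{R}^n$ let the erosion $e_r(X)$ of $X$ by $r$ be $X\setminus\bigcup_{y\notin X}B(r,y)$, where $B(r,y)$ is the open ball of radius $r$ about $y$; $X$ is resilient to erosion by the radius $r$ if $e_r(X)=\sigma(X)$ for some Euclidean similarity transformation $\sigma$ of $\mathbb{R}^n$. A convex body is a closed convex set. A closed half-space $H\supset X$ is a supporting half-space of $X$ at a point $x$ of the boundary of $X$ if $x$ also lies on the boundary of $H$; the point $x$ is regular if there is exactly one supporting half-space of $X$ at $x$, a supporting half-space is regular if it is supporting at some regular point of $X$, and a regular supporting hyperplane of $X$ is the boundary of a regular supporting half-space. A closed ball $B$ is inscribed in a convex body $X$ if $B\subset X$ and $B$ meets every regular supporting hyperplane of $X$. Theorem. Let $X\subset\mathbb{R}^n$ be a nonempty bounded set and let $r>0$. Then $X$ is resilient to erosion by the radius $r$ if and only if $X$ is a convex body which has an inscribed ball of radius $>r$. -/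

import Mathlib

/-- The erosion of `X` by the radius `r`: the points of `X` lying in no open ball of radius `r`
centred at a point of the complement of `X`. -/
def erosion {n : ℕ} (r : ℝ) (X : Set (EuclideanSpace ℝ (Fin n))) :
    Set (EuclideanSpace ℝ (Fin n)) :=
  X \ ⋃ y ∈ Xᶜ, Metric.ball y r

/-- `X` is resilient to erosion by the radius `r`: some Euclidean similarity transformation of
the whole space (a bijection multiplying all distances by one fixed positive factor) carries `X`
onto its erosion by `r`. -/
def IsResilientTo {n : ℕ} (X : Set (EuclideanSpace ℝ (Fin n))) (r : ℝ) : Prop :=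
  ∃ σ : EuclideanSpace ℝ (Fin n) ≃ᵈ EuclideanSpace ℝ (Fin n), σ '' X = erosion r X

/-- A convex body, in the sense used here: a closed convex set. -/
def IsConvexBody {n : ℕ} (X : Set (EuclideanSpace ℝ (Fin n))) : Prop :=
  IsClosed X ∧ Convex ℝ X

/-- Closed half-spaces. -/
def IsClosedHalfSpace {n : ℕ} (H : Set (EuclideanSpace ℝ (Fin n))) : Prop :=
  ∃ (u : EuclideanSpace ℝ (Fin n)) (c : ℝ), u ≠ 0 ∧ H = {x | inner ℝ u x ≤ c}

/-- `H` is a supporting half-space of `X` at the boundary point `x` of `X`. -/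
def IsSupportingHalfSpaceAt {n : ℕ} (X H : Set (EuclideanSpace ℝ (Fin n)))
    (x : EuclideanSpace ℝ (Fin n)) : Prop :=
  IsClosedHalfSpace H ∧ X ⊆ H ∧ x ∈ frontier X ∧ x ∈ frontier H

/-- `x` is a regular boundary point of `X`: it has exactly one supporting half-space. -/
def IsRegularPoint {n : ℕ} (X : Set (EuclideanSpace ℝ (Fin n)))
    (x : EuclideanSpace ℝ (Fin n)) : Prop :=
  x ∈ frontier X ∧ ∃! H : Set (EuclideanSpace ℝ (Fin n)), IsSupportingHalfSpaceAt X H x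

/-- `H` is a regular supporting half-space of `X`: it is supporting at a regular point. -/
def IsRegularSupportingHalfSpace {n : ℕ} (X H : Set (EuclideanSpace ℝ (Fin n))) : Prop :=
  ∃ x, IsRegularPoint X x ∧ IsSupportingHalfSpaceAt X H x

/-- `P` is a regular supporting hyperplane of `X`: the boundary of a regular supporting
half-space. -/
def IsRegularSupportingHyperplane {n : ℕ} (X P : Set (EuclideanSpace ℝ (Fin n))) : Prop :=
  ∃ H, IsRegularSupportingHalfSpace X H ∧ P = frontier H

/-- The closed ball of centre `c` and radius `R` is inscribed in `X`: it lies in `X` and meets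
all the regular supporting hyperplanes of `X`. -/
def IsInscribedBall {n : ℕ} (X : Set (EuclideanSpace ℝ (Fin n)))
    (c : EuclideanSpace ℝ (Fin n)) (R : ℝ) : Prop :=
  Metric.closedBall c R ⊆ X ∧
    ∀ P, IsRegularSupportingHyperplane X P → (Metric.closedBall c R ∩ P).Nonempty

/-! ### Half-spaces and their unit normals. -/

section HalfSpaces

variable {E : Type*} [NormedAddCommGroup E] [InnerProductSpace ℝ E]

/-! A point survives erosion exactly when its open `r`-ball lies in `X`.

From an inscribed ball of centre `c` and radius `R > r`, the similarity is the homothety about `c`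
of ratio `(R - r) / R`. Convexity puts the image of `X` inside the erosion. Conversely, a closed
convex set with interior is cut out by its regular supporting half-spaces
(`exists_unique_normal_separating`, by Rademacher's theorem for the gauge), and here these all have
boundary at distance exactly `R` from `c`; pushing them inwards by `r` is the same as scaling them
by that ratio.

Conversely, in positive dimension boundedness forces `σ` to have ratio `l < 1`. About its fixed
point, `σ` is `l • A` with `A` a linear isometry; put `R = r / (1 - l)`. Iteration gives the same
equivalence with `l ^ k`, `A ^ k` and radius `R * (1 - l ^ k)` (`mem_iff_ball_pow_subset`). Large
`k` puts the `R`-ball in `X`; pulled back, it puts each outside point in huge balls missing `X`,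
whence convexity. Finally `A ^ k` returns close to the identity on a given normal, which bounds
regular support distances by `R` (`inner_le_of_unique_normal`). -/

theorem frontier_setOf_inner_le {u : E} (hu : u ≠ 0) (c : ℝ) :
    frontier {x : E | inner ℝ u x ≤ c} = {x | inner ℝ u x = c} := by
  have ho : IsOpenMap (innerSL ℝ u) :=
    (innerSL ℝ u).isOpenMap_of_ne_zero (by
      intro h
      exact hu (by simpa using congrArg (fun f => f u) h))
  have := ho.preimage_frontier_eq_frontier_preimage (innerSL ℝ u).continuous (Set.Iic c)
  rw [frontier_Iic] at this
  exact this.symm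

/-- Moving in the direction `v - u` never leaves the first half-space, but leaves the second unless
`u = v`. This turns uniqueness of a supporting half-space into uniqueness of a unit normal. -/
theorem eq_of_halfSpace_subset_halfSpace {u v : E} (hu : ‖u‖ = 1) (hv : ‖v‖ = 1) {c d : ℝ}
    (h : {x : E | inner ℝ u x ≤ c} ⊆ {x | inner ℝ v x ≤ d}) : u = v := by
  rw [← inner_eq_one_iff_of_norm_eq_one (𝕜 := ℝ) hu hv]
  by_contra hne
  set s : ℝ := inner ℝ u v with hs
  have hs1 : s < 1 := lt_of_le_of_ne
    (by have := real_inner_le_norm u v; rwa [hu, hv, one_mul] at this) hne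
  have huu : (inner ℝ u u : ℝ) = 1 := by rw [real_inner_self_eq_norm_sq, hu, one_pow]
  have hvv : (inner ℝ v v : ℝ) = 1 := by rw [real_inner_self_eq_norm_sq, hv, one_pow]
  have hvu : (inner ℝ v u : ℝ) = s := by rw [real_inner_comm]
  set t : ℝ := (|d - c * s| + 1) / (1 - s) with ht
  have ht0 : 0 ≤ t := div_nonneg (by positivity) (by linarith)
  have hts : t * (1 - s) = |d - c * s| + 1 := div_mul_cancel₀ _ (by linarith)
  have hmem : c • u + t • (v - u) ∈ {x : E | inner ℝ u x ≤ c} := by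
    simp only [Set.mem_ofPred_eq, inner_add_right, inner_smul_right, inner_sub_right, huu, ← hs]
    nlinarith
  have := h hmem
  simp only [Set.mem_ofPred_eq, inner_add_right, inner_smul_right, inner_sub_right, hvv, hvu] at this
  have := le_abs_self (d - c * s)
  linarith

end HalfSpaces

/-! ### Separation by regular supporting hyperplanes, through the gauge. -/

section RegularSeparation

variable {E : Type*} [NormedAddCommGroup E] [InnerProductSpace ℝ E] [FiniteDimensional ℝ E]

/-- A closed convex neighbourhood of the origin is the intersection of its supporting half-spaces
at the points where the normalised outer normal is unique. -/
theorem exists_unique_normal_separating {X : Set E} (hcl : IsClosed X) (hcv : Convex ℝ X)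
    (h0 : X ∈ nhds (0 : E)) {z : E} (hz : z ∉ X) :
    ∃ y ∈ X, ∃ u : E, inner ℝ u y = (1 : ℝ) ∧ (∀ x ∈ X, inner ℝ u x ≤ (1 : ℝ)) ∧
      (∀ v : E, inner ℝ v y = (1 : ℝ) → (∀ x ∈ X, inner ℝ v x ≤ (1 : ℝ)) → v = u) ∧
      (1 : ℝ) < inner ℝ u z := by
  borelize E
  have habs : Absorbent ℝ X := absorbent_nhds_zero h0
  obtain ⟨K, hK⟩ := hcv.lipschitz_gauge h0
  have hX : ∀ x, gauge X x ≤ 1 ↔ x ∈ X := fun x => by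
    rw [gauge_le_one_iff_mem_closure hcv h0, hcl.closure_eq]
  have hsm : ∀ (a : ℝ) (x : E), 0 ≤ a → gauge X (a • x) = a * gauge X x := fun a x ha => by
    rw [gauge_smul_of_nonneg ha, smul_eq_mul]
  have hgz : 1 < gauge X z := not_le.1 fun h => hz ((hX z).1 h)
  have hd : Dense {x | DifferentiableAt ℝ (gauge X) x} :=
    MeasureTheory.Measure.dense_of_ae
      (hK.ae_differentiableAt (μ := MeasureTheory.Measure.addHaar))
  -- The gradient has norm at most `K`, so at a differentiability point with `1 < F x` it still
  -- exceeds 1 at `z`.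
  set F : E → ℝ := fun x => gauge X x - K * dist z x with hF
  have hFc : Continuous F := by
    have := hK.continuous
    fun_prop
  have hopen : IsOpen {x | 1 < F x} := isOpen_lt continuous_const hFc
  obtain ⟨x, hxF, hxd⟩ := hd.inter_open_nonempty _ hopen ⟨z, by simpa [hF] using hgz⟩
  simp only [Set.mem_ofPred_eq, hF] at hxF hxd
  have hgx : 1 < gauge X x := by
    have : 0 ≤ (K : ℝ) * dist z x := by positivity
    linarith
  have hgx0 : 0 < gauge X x := by linarith
  set L := fderiv ℝ (gauge X) x with hL
  have hLd : HasFDerivAt (gauge X) L x := hxd.hasFDerivAt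
  have hline : ∀ w, HasDerivAt (fun t : ℝ => gauge X (x + t • w)) (L w) 0 := by
    intro w
    have h1 : HasDerivAt (fun t : ℝ => x + t • w) w 0 := by
      simpa using ((hasDerivAt_id (0 : ℝ)).smul_const w).const_add x
    have h2 : HasFDerivAt (gauge X) L (x + (0 : ℝ) • w) := by simpa using hLd
    exact h2.comp_hasDerivAt 0 h1
  have hle : ∀ (w : E), L w ≤ gauge X w := by
    intro w
    have hw := (hline w).hasDerivWithinAt (s := Set.Ici 0) |>.Ioi_of_Ici
    rw [hasDerivWithinAt_iff_tendsto_slope' (by simp)] at hw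
    refine le_of_tendsto hw ?_
    filter_upwards [self_mem_nhdsWithin] with t ht
    have ht : 0 < t := ht
    rw [slope_def_field, zero_smul, add_zero, sub_zero, div_le_iff₀ ht]
    have := gauge_add_le hcv habs x (t • w)
    rw [hsm t w ht.le] at this
    linarith
  -- Euler's identity for a positively homogeneous function.
  have hLx : L x = gauge X x := by
    have h1 := hline x
    have h2 : HasDerivAt (fun t : ℝ => gauge X (x + t • x)) (gauge X x) 0 := by
      have h3 : HasDerivAt (fun t : ℝ => (1 + t) * gauge X x) (gauge X x) 0 := by
        simpa using ((hasDerivAt_id (0 : ℝ)).const_add 1).mul_const (gauge X x)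
      refine h3.congr_of_eventuallyEq ?_
      filter_upwards [Ioi_mem_nhds (show (-1 : ℝ) < 0 by norm_num)] with t ht
      have ht : -1 < t := ht
      rw [← hsm (1 + t) x (by linarith), add_smul, one_smul]
    exact h1.unique h2
  set u : E := (InnerProductSpace.toDual ℝ E).symm L with hu
  have huL : ∀ w, inner ℝ u w = L w := fun w => by
    rw [hu, InnerProductSpace.toDual_symm_apply]
  refine ⟨(gauge X x)⁻¹ • x, ?_, u, ?_, ?_, ?_, ?_⟩
  · rw [← hX, hsm _ _ (by positivity), inv_mul_cancel₀ hgx0.ne']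
  · rw [inner_smul_right, huL, hLx, inv_mul_cancel₀ hgx0.ne']
  · intro w hw
    rw [huL]
    exact (hle w).trans ((hX w).2 hw)
  · intro v hvy hv
    rw [inner_smul_right, inv_mul_eq_one₀ hgx0.ne'] at hvy
    have hvg : ∀ w, inner ℝ v w ≤ gauge X w := by
      intro w
      refine le_of_forall_gt_imp_ge_of_dense fun a ha => ?_
      have ha0 : 0 < a := (gauge_nonneg w).trans_lt ha
      have := hv (a⁻¹ • w) (by
        rw [← hX, hsm _ _ (by positivity), inv_mul_le_one₀ ha0]
        exact ha.le)
      rwa [inner_smul_right, inv_mul_le_one₀ ha0] at this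
    -- A competing normal lies below the gauge and touches it at `x`, so differentiability forces it
    -- to be the gradient.
    have hmin : IsLocalMin (fun w => gauge X w - inner ℝ v w) x := by
      refine Filter.Eventually.of_forall fun w => ?_
      simp only [← hvy, sub_self]
      linarith [hvg w]
    have hz0 := hmin.hasFDerivAt_eq_zero (hLd.sub (innerSL ℝ v).hasFDerivAt)
    refine ext_inner_right ℝ fun w => ?_
    have := congrArg (fun f : E →L[ℝ] ℝ => f w) hz0
    simp only [sub_apply, innerSL_apply_apply,
      zero_apply] at this
    rw [huL]
    linarith
  · have h1 : L z = gauge X x + L (z - x) := by rw [map_sub, hLx]; ring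
    have h2 : ‖L (z - x)‖ ≤ K * ‖z - x‖ :=
      (L.le_opNorm _).trans (mul_le_mul_of_nonneg_right
        (norm_fderiv_le_of_lipschitz ℝ hK) (norm_nonneg _))
    rw [huL, h1]
    rw [dist_eq_norm] at hxF
    have := neg_abs_le (L (z - x))
    rw [Real.norm_eq_abs] at h2
    linarith

end RegularSeparation

/-! ### Iterating the rescaled erosion; convexity. -/

section SelfSimilarErosion

variable {E : Type*} [NormedAddCommGroup E] [InnerProductSpace ℝ E]

/-- Successive erosions add their radii, and these form a geometric series: hence the
parametrisation of the first radius as `R * (1 - l)`. -/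
theorem mem_iff_ball_pow_subset {X : Set E} {A : E ≃ₗᵢ[ℝ] E} {l R : ℝ} (hl0 : 0 < l) (hl1 : l < 1)
    (hR : 0 < R) (hX : ∀ x, x ∈ X ↔ Metric.ball (l • A x) (R * (1 - l)) ⊆ X) (k : ℕ) (x : E) :
    x ∈ X ↔ Metric.ball (l ^ (k + 1) • (A ^ (k + 1)) x) (R * (1 - l ^ (k + 1))) ⊆ X := by
  induction k generalizing x with
  | zero => simpa using hX x
  | succ k ih =>
    have hlk : 0 < l ^ (k + 1) := pow_pos hl0 _
    have hpos : 0 < R * (1 - l ^ (k + 1)) :=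
      mul_pos hR (sub_pos.2 (pow_lt_one₀ hl0.le hl1 k.succ_ne_zero))
    have hr : 0 < R * (1 - l) := mul_pos hR (sub_pos.2 hl1)
    have hdist : ∀ y, dist (l ^ (k + 1) • (A ^ (k + 1)) y) (l ^ (k + 1 + 1) • (A ^ (k + 1 + 1)) x) =
        l ^ (k + 1) * dist y (l • A x) := by
      intro y
      rw [pow_succ l (k + 1), pow_succ A (k + 1), LinearIsometryEquiv.coe_mul,
        Function.comp_apply, mul_smul,
        ← map_smul (A ^ (k + 1)) l, dist_smul₀, LinearIsometryEquiv.dist_map, Real.norm_of_nonneg hlk.le]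
    have hsum : R * (1 - l ^ (k + 1 + 1)) =
        R * (1 - l ^ (k + 1)) + l ^ (k + 1) * (R * (1 - l)) := by ring
    rw [hX]
    constructor
    · intro h p hp
      rw [Metric.mem_ball, hsum] at hp
      -- The big ball is the sum of two smaller ones; `m` is the intermediate centre.
      obtain ⟨m, hm1, hm2⟩ := exists_dist_lt_lt hpos (mul_pos hlk hr) (hp.trans_eq (add_comm _ _))
      obtain ⟨y, rfl⟩ : ∃ y, l ^ (k + 1) • (A ^ (k + 1)) y = m :=
        ⟨(A ^ (k + 1)).symm ((l ^ (k + 1))⁻¹ • m), by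
          rw [LinearIsometryEquiv.apply_symm_apply, smul_inv_smul₀ hlk.ne']⟩
      rw [hdist] at hm2
      exact (ih y).1 (h (lt_of_mul_lt_mul_left hm2 hlk.le)) hm1
    · intro h y hy
      refine (ih y).2 fun p hp => h ?_
      rw [Metric.mem_ball] at hp hy ⊢
      have h1 := dist_triangle p (l ^ (k + 1) • (A ^ (k + 1)) y)
        (l ^ (k + 1 + 1) • (A ^ (k + 1 + 1)) x)
      rw [hdist] at h1
      have h2 := mul_lt_mul_of_pos_left hy hlk
      linarith

theorem zero_mem_of_mem_iff_ball_subset {X : Set E} {A : E ≃ₗᵢ[ℝ] E} {l R : ℝ} (hl0 : 0 < l)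
    (hl1 : l < 1) (hR : 0 < R) (hne : X.Nonempty) (hcl : IsClosed X)
    (hX : ∀ x, x ∈ X ↔ Metric.ball (l • A x) (R * (1 - l)) ⊆ X) : (0 : E) ∈ X := by
  obtain ⟨x, hx⟩ := hne
  have hlim : Filter.Tendsto (fun k : ℕ => l ^ (k + 1) • (A ^ (k + 1)) x) Filter.atTop (nhds 0) := by
    rw [tendsto_zero_iff_norm_tendsto_zero]
    have : Filter.Tendsto (fun k : ℕ => l ^ (k + 1) * ‖x‖) Filter.atTop (nhds 0) := by
      simpa using ((tendsto_pow_atTop_nhds_zero_of_lt_one hl0.le hl1).comp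
        (Filter.tendsto_add_atTop_nat 1)).mul_const ‖x‖
    refine this.congr fun k => ?_
    rw [norm_smul, LinearIsometryEquiv.norm_map, Real.norm_of_nonneg (pow_pos hl0 _).le]
  refine hcl.mem_of_tendsto hlim (Filter.Eventually.of_forall fun k => ?_)
  exact (mem_iff_ball_pow_subset hl0 hl1 hR hX k x).1 hx (Metric.mem_ball_self
    (mul_pos hR (sub_pos.2 (pow_lt_one₀ hl0.le hl1 k.succ_ne_zero))))

theorem closedBall_subset_of_mem_iff_ball_subset {X : Set E} {A : E ≃ₗᵢ[ℝ] E} {l R : ℝ}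
    (hl0 : 0 < l) (hl1 : l < 1) (hR : 0 < R) (hcl : IsClosed X) (h0 : (0 : E) ∈ X)
    (hX : ∀ x, x ∈ X ↔ Metric.ball (l • A x) (R * (1 - l)) ⊆ X) :
    Metric.closedBall 0 R ⊆ X := by
  rw [← closure_ball _ hR.ne']
  refine closure_minimal (fun x hx => ?_) hcl
  rw [mem_ball_zero_iff] at hx
  have hlim : Filter.Tendsto (fun k : ℕ => R * (1 - l ^ (k + 1))) Filter.atTop (nhds R) := by
    simpa using (((tendsto_pow_atTop_nhds_zero_of_lt_one hl0.le hl1).comp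
        (Filter.tendsto_add_atTop_nat 1)).const_sub 1).const_mul R
  obtain ⟨k, hk⟩ := (hlim.eventually (lt_mem_nhds hx)).exists
  refine (mem_iff_ball_pow_subset hl0 hl1 hR hX k 0).1 h0 ?_
  rwa [map_zero, smul_zero, mem_ball_zero_iff]

/-- A point outside a set can be placed in arbitrarily large balls missing the set, as soon as the
set is a fixed point of the rescaled erosion. -/
theorem exists_ball_disjoint {X : Set E} {A : E ≃ₗᵢ[ℝ] E} {l R : ℝ}
    (hl0 : 0 < l) (hl1 : l < 1) (hR : 0 < R)
    (hX : ∀ x, x ∈ X ↔ Metric.ball (l • A x) (R * (1 - l)) ⊆ X) {z : E} (hz : z ∉ X) (M : ℝ) :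
    ∃ (w : E) (ρ : ℝ), M < ρ ∧ dist z w < ρ ∧ ∀ x ∈ X, ρ ≤ dist x w := by
  -- This is the radius `R * (1 - l ^ (k + 1))` after pulling back by the contraction.
  have hlim : Filter.Tendsto (fun k : ℕ => R * ((l⁻¹) ^ (k + 1) - 1)) Filter.atTop Filter.atTop :=
    (Filter.tendsto_atTop_add_const_right _ _ ((tendsto_pow_atTop_atTop_of_one_lt
      ((one_lt_inv₀ hl0).2 hl1)).comp (Filter.tendsto_add_atTop_nat 1))).const_mul_atTop hR
  obtain ⟨k, hk⟩ := (hlim.eventually_gt_atTop M).exists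
  have hlk : 0 < l ^ (k + 1) := pow_pos hl0 _
  have hiter := mem_iff_ball_pow_subset hl0 hl1 hR hX k
  rw [hiter, Set.not_subset] at hz
  obtain ⟨p, hp, hpX⟩ := hz
  set w := (A ^ (k + 1)).symm ((l ^ (k + 1))⁻¹ • p) with hw
  have hpw : p = l ^ (k + 1) • (A ^ (k + 1)) w := by
    rw [hw, LinearIsometryEquiv.apply_symm_apply, smul_inv_smul₀ hlk.ne']
  have hd : ∀ x, dist p (l ^ (k + 1) • (A ^ (k + 1)) x) = l ^ (k + 1) * dist x w := by
    intro x
    rw [hpw, dist_smul₀, LinearIsometryEquiv.dist_map, Real.norm_of_nonneg hlk.le, dist_comm]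
  have hρ : l ^ (k + 1) * (R * ((l⁻¹) ^ (k + 1) - 1)) = R * (1 - l ^ (k + 1)) := by
    rw [inv_pow]; field_simp
  refine ⟨w, _, hk, ?_, fun x hx => ?_⟩
  · rw [Metric.mem_ball, hd, ← hρ] at hp
    exact lt_of_mul_lt_mul_left hp hlk.le
  · refine le_of_not_gt fun h => hpX ((hiter x).1 hx ?_)
    rw [Metric.mem_ball, hd, ← hρ]
    exact mul_lt_mul_of_pos_left h hlk

/-- A bounded closed set, around the origin, is convex when each outside point lies in
arbitrarily large balls missing the set. -/
theorem convex_of_exists_ball_disjoint {X : Set E} (hcl : IsClosed X)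
    (hb : Bornology.IsBounded X) (h0 : X ∈ nhds (0 : E))
    (hX : ∀ z ∉ X, ∀ M : ℝ, ∃ (w : E) (ρ : ℝ), M < ρ ∧ dist z w < ρ ∧ ∀ x ∈ X, ρ ≤ dist x w) :
    Convex ℝ X := by
  have h0X : (0 : E) ∈ X := mem_of_mem_nhds h0
  set C := convexHull ℝ X with hC
  have hCc : Convex ℝ C := convex_convexHull ℝ X
  have hXC : X ⊆ C := subset_convexHull ℝ X
  have hint : interior C ⊆ X := by
    intro z hz
    by_contra hzX
    obtain ⟨δ, hδ, hball⟩ := Metric.nhds_basis_closedBall.mem_iff.1 (mem_interior_iff_mem_nhds.1 hz)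
    obtain ⟨D, hD⟩ := hb.subset_closedBall z
    -- A huge ball is nearly a half-space: on the scale `D` of `X` it misses one by at most `D ^ 2 /
    -- 2` in the functional `w - z`. The radius is chosen so that the point of the hull at distance
    -- `δ` from `z` towards `w` violates this.
    obtain ⟨w, ρ, hMρ, hzw, hρ⟩ := hX z hzX (‖z‖ + D ^ 2 / (2 * δ))
    have hw : ρ ≤ ‖w‖ := by simpa [dist_eq_norm] using hρ 0 h0X
    have hzρ : 0 ≤ D ^ 2 / (2 * δ) := by positivity
    set N := ‖w - z‖ with hN
    have hNlow : D ^ 2 / (2 * δ) < N := by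
      have : ‖w‖ ≤ N + ‖z‖ := by simpa using norm_add_le (w - z) z
      linarith
    have hNpos : 0 < N := hzρ.trans_lt hNlow
    have hlin : X ⊆ {x | inner ℝ (w - z) x ≤ inner ℝ (w - z) z + D ^ 2 / 2} := by
      intro x hx
      have h1 : dist z w ^ 2 ≤ dist x w ^ 2 :=
        pow_le_pow_left₀ dist_nonneg (hzw.le.trans (hρ x hx)) 2
      have h2 : ‖x - z‖ ^ 2 ≤ D ^ 2 := by
        rw [← dist_eq_norm]; exact pow_le_pow_left₀ dist_nonneg (hD hx) 2
      have h3 : dist x w ^ 2 = ‖x - z‖ ^ 2 - 2 * inner ℝ (x - z) (w - z) + dist z w ^ 2 := by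
        rw [dist_eq_norm, dist_comm, dist_eq_norm, ← norm_sub_sq_real]
        congr 2; abel
      have h4 : (inner ℝ (x - z) (w - z) : ℝ) = inner ℝ (w - z) x - inner ℝ (w - z) z := by
        rw [real_inner_comm, inner_sub_right]
      simp only [Set.mem_ofPred_eq]
      linarith
    have hlinC : C ⊆ {x | inner ℝ (w - z) x ≤ inner ℝ (w - z) z + D ^ 2 / 2} :=
      convexHull_min hlin (convex_halfSpace_le (innerSL ℝ (w - z)).toLinearMap.isLinear _)
    have hmem : z + (δ / N) • (w - z) ∈ Metric.closedBall z δ := by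
      rw [Metric.mem_closedBall, dist_eq_norm, add_sub_cancel_left, norm_smul,
        Real.norm_of_nonneg (by positivity), ← hN, div_mul_cancel₀ _ hNpos.ne']
    have h5 := hlinC (hball hmem)
    simp only [Set.mem_ofPred_eq, inner_add_right, inner_smul_right, real_inner_self_eq_norm_sq,
      ← hN] at h5
    have h6 : δ / N * N ^ 2 = δ * N := by field_simp
    rw [h6] at h5
    rw [div_lt_iff₀ (by positivity)] at hNlow
    linarith
  have hCi : (interior C).Nonempty :=
    ⟨0, interior_mono hXC (mem_interior_iff_mem_nhds.2 h0)⟩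
  have hCX : C ⊆ X := subset_closure.trans <| by
    rw [← hCc.closure_interior_eq_closure_of_nonempty_interior hCi]
    exact closure_minimal hint hcl
  rw [hXC.antisymm hCX]
  exact hCc

end SelfSimilarErosion

/-! ### Regular supporting hyperplanes lie within distance `R`. -/

section UniqueNormal

variable {E : Type*} [NormedAddCommGroup E] [InnerProductSpace ℝ E] [FiniteDimensional ℝ E]

/-- Unit vectors that nearly support `X` at `y` are close to the unique unit normal at `y`. -/
theorem exists_forall_dist_lt_of_unique_normal {X : Set E} {y u : E}
    (huniq : ∀ v : E, ‖v‖ = 1 → (∀ x ∈ X, inner ℝ v x ≤ (inner ℝ v y : ℝ)) → v = u)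
    {ε : ℝ} (hε : 0 < ε) :
    ∃ t : ℝ, 0 < t ∧ t ≤ 1 ∧ ∀ v : E, ‖v‖ = 1 →
      (∀ x ∈ X, inner ℝ v x ≤ (1 + t) * (inner ℝ v y : ℝ)) → dist v u < ε := by
  by_contra! hcon
  choose! v hv1 hv2 hv3 using hcon
  set s : ℕ → ℝ := fun m => 1 / ((m : ℝ) + 1) with hs
  have hs0 : ∀ m, 0 < s m := fun m => Nat.one_div_pos_of_nat
  have hs1 : ∀ m, s m ≤ 1 := fun m => by
    rw [hs]; simpa using Nat.one_div_le_one_div (α := ℝ) (Nat.zero_le m)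
  obtain ⟨w, hw, φ, hφ, hlim⟩ := (isCompact_sphere (0 : E) 1).tendsto_subseq
    (x := fun m => v (s m)) (fun m => by simpa using hv1 (s m) (hs0 m) (hs1 m))
  have hw1 : ‖w‖ = 1 := by simpa using hw
  have hslim : Filter.Tendsto (fun m => s (φ m)) Filter.atTop (nhds 0) :=
    (tendsto_one_div_add_atTop_nhds_zero_nat (𝕜 := ℝ)).comp hφ.tendsto_atTop
  have hwu : w = u := by
    refine huniq w hw1 fun x hx => ?_
    have h1 : Filter.Tendsto (fun m => (inner ℝ (v (s (φ m))) x : ℝ)) Filter.atTop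
        (nhds (inner ℝ w x)) := Filter.Tendsto.inner hlim tendsto_const_nhds
    have h2 : Filter.Tendsto (fun m => (1 + s (φ m)) * (inner ℝ (v (s (φ m))) y : ℝ)) Filter.atTop
        (nhds (inner ℝ w y)) := by
      simpa using (hslim.const_add 1).mul
        (Filter.Tendsto.inner hlim (tendsto_const_nhds (x := y)) (𝕜 := ℝ))
    exact le_of_tendsto_of_tendsto' h1 h2 fun m => hv2 _ (hs0 _) (hs1 _) x hx
  have h3 : Filter.Tendsto (fun m => dist (v (s (φ m))) u) Filter.atTop (nhds (dist w u)) :=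
    hlim.dist tendsto_const_nhds
  have := ge_of_tendsto' h3 fun m => hv3 _ (hs0 (φ m)) (hs1 _)
  rw [hwu, dist_self] at this
  linarith

/-- Recurrence of the powers of a linear isometry. -/
theorem exists_pow_dist_lt (A : E ≃ₗᵢ[ℝ] E) (u : E) {ε : ℝ} (hε : 0 < ε) (K : ℕ) :
    ∃ k, K < k ∧ dist ((A ^ k) u) u < ε := by
  obtain ⟨w, -, φ, hφ, hlim⟩ := (isCompact_closedBall (0 : E) ‖u‖).tendsto_subseq
    (x := fun m : ℕ => (A ^ m) u) (fun m => by simp)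
  obtain ⟨N, hN⟩ := Metric.cauchySeq_iff'.1 hlim.cauchySeq ε hε
  have hle : φ N + K + 1 ≤ φ (N + (K + 1)) := by
    have := hφ.add_le_nat (K + 1) N
    rw [add_comm (K + 1) N] at this
    omega
  refine ⟨φ (N + (K + 1)) - φ N, by omega, ?_⟩
  have := hN (N + (K + 1)) (by omega)
  simp only [Function.comp_apply] at this
  -- Two close points of the orbit; the common isometry `A ^ φ N` cancels.
  rwa [← Nat.add_sub_cancel' (show φ N ≤ φ (N + (K + 1)) by omega), pow_add,
    LinearIsometryEquiv.coe_mul, Function.comp_apply, LinearIsometryEquiv.dist_map] at this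

/-- If `X` is a fixed point of the rescaled erosion, its supporting hyperplanes at points with a
unique normal are at distance at most `R` from the centre. -/
theorem inner_le_of_unique_normal {X : Set E} {A : E ≃ₗᵢ[ℝ] E} {l R : ℝ}
    (hl0 : 0 < l) (hl1 : l < 1) (hR : 0 < R) (hcl : IsClosed X) (hcv : Convex ℝ X)
    (h0 : Metric.closedBall 0 R ⊆ X)
    (hX : ∀ x, x ∈ X ↔ Metric.ball (l • A x) (R * (1 - l)) ⊆ X) {y u : E} (hy : y ∈ X)
    (hu : ‖u‖ = 1) (huy : ∀ x ∈ X, inner ℝ u x ≤ (inner ℝ u y : ℝ))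
    (huniq : ∀ v : E, ‖v‖ = 1 → (∀ x ∈ X, inner ℝ v x ≤ (inner ℝ v y : ℝ)) → v = u) :
    (inner ℝ u y : ℝ) ≤ R := by
  have hypos : 0 < (inner ℝ u y : ℝ) := by
    have h1 : R • u ∈ X := h0 (by
      rw [mem_closedBall_zero_iff, norm_smul, hu, mul_one, Real.norm_of_nonneg hR.le])
    have := huy _ h1
    rw [inner_smul_right, real_inner_self_eq_norm_sq, hu] at this
    linarith
  have hkey : ∀ ε : ℝ, 0 < ε → (inner ℝ u y : ℝ) ≤ R + ε * (4 * ‖y‖) := by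
    intro ε hε
    obtain ⟨t, ht0, ht1, ht⟩ := exists_forall_dist_lt_of_unique_normal huniq hε
    obtain ⟨K, hK⟩ := exists_pow_lt_of_lt_one hε hl1
    obtain ⟨k, hKk, hk⟩ := exists_pow_dist_lt A u hε K
    obtain ⟨j, rfl⟩ : ∃ j, k = j + 1 := ⟨k - 1, by omega⟩
    have hlk : 0 < l ^ (j + 1) := pow_pos hl0 _
    have hlkε : l ^ (j + 1) < ε := (pow_le_pow_of_le_one hl0.le hl1.le hKk.le).trans_lt hK
    set ρ := R * (1 - l ^ (j + 1)) with hρ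
    have hρ0 : 0 < ρ := mul_pos hR (sub_pos.2 (pow_lt_one₀ hl0.le hl1 j.succ_ne_zero))
    have hρR : ρ ≤ R := by nlinarith
    have hiter := mem_iff_ball_pow_subset hl0 hl1 hR hX j
    have hout : (1 + t) • y ∉ X := fun h => by
      have := huy _ h
      rw [inner_smul_right] at this
      nlinarith
    -- Since `(1 + t) • y` is just outside `X`, its ball contains a point `w` outside `X`; let `v`
    -- separate `w` from `X`. Pulled back by `A ^ (j + 1)`, `v` nearly supports `X` at `y`, so it is
    -- near `u`; by recurrence `v` itself is near `u`. But `w` is within about `R` of the origin.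
    rw [hiter, Set.not_subset] at hout
    obtain ⟨w, hw, hwX⟩ := hout
    obtain ⟨f, a, hfa, haf⟩ := geometric_hahn_banach_closed_point hcv hcl hwX
    set g := (InnerProductSpace.toDual ℝ E).symm f with hg
    have hgf : ∀ x, inner ℝ g x = f x := fun x => by
      rw [hg, InnerProductSpace.toDual_symm_apply]
    have hg0 : g ≠ 0 := fun h => by
      have h1 := hfa y hy
      rw [← hgf, h, inner_zero_left] at h1
      rw [← hgf, h, inner_zero_left] at haf
      linarith
    have hgn : 0 < ‖g‖ := norm_pos_iff.2 hg0
    set v := ‖g‖⁻¹ • g with hv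
    have hvn : ‖v‖ = 1 := by
      rw [hv, norm_smul, norm_inv, norm_norm, inv_mul_cancel₀ hgn.ne']
    have hsep : ∀ x ∈ X, (inner ℝ v x : ℝ) < inner ℝ v w := by
      intro x hx
      rw [hv, real_inner_smul_left, real_inner_smul_left, hgf, hgf]
      exact mul_lt_mul_of_pos_left ((hfa x hx).trans haf) (inv_pos.2 hgn)
    have hvw : (inner ℝ v w : ℝ) ≤
        l ^ (j + 1) * ((1 + t) * inner ℝ v ((A ^ (j + 1)) y)) + ρ := by
      have h1 : (inner ℝ v (w - l ^ (j + 1) • (A ^ (j + 1)) ((1 + t) • y)) : ℝ) ≤ ρ := by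
        refine (real_inner_le_norm _ _).trans ?_
        rw [hvn, one_mul, ← dist_eq_norm]
        exact (Metric.mem_ball.1 hw).le
      rw [inner_sub_right, map_smul, inner_smul_right, inner_smul_right] at h1
      linarith
    have hnear : ∀ x ∈ X,
        (inner ℝ v ((A ^ (j + 1)) x) : ℝ) ≤ (1 + t) * inner ℝ v ((A ^ (j + 1)) y) := by
      intro x hx
      have hmem : l ^ (j + 1) • (A ^ (j + 1)) x + ρ • v ∈ X := by
        have h1 := closure_minimal ((hiter x).1 hx) hcl
        rw [closure_ball _ hρ0.ne'] at h1
        refine h1 ?_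
        rw [Metric.mem_closedBall, dist_eq_norm, add_sub_cancel_left, norm_smul, hvn, mul_one,
          Real.norm_of_nonneg hρ0.le]
      have h2 := (hsep _ hmem).le.trans hvw
      rw [inner_add_right, inner_smul_right, inner_smul_right, real_inner_self_eq_norm_sq,
        hvn, one_pow, mul_one] at h2
      exact le_of_mul_le_mul_left (by linarith) hlk
    set v' := (A ^ (j + 1)).symm v with hv'
    have hvv' : v = (A ^ (j + 1)) v' := by rw [hv', LinearIsometryEquiv.apply_symm_apply]
    have hv'u : dist v' u < ε := by
      refine ht v' (by rw [hv', LinearIsometryEquiv.norm_map, hvn]) fun x hx => ?_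
      have := hnear x hx
      rwa [hvv', LinearIsometryEquiv.inner_map_map, LinearIsometryEquiv.inner_map_map] at this
    have hvu : ‖u - v‖ ≤ 2 * ε := by
      rw [← dist_eq_norm]
      have h1 := dist_triangle v ((A ^ (j + 1)) u) u
      have h2 : dist v ((A ^ (j + 1)) u) = dist v' u := by
        rw [hvv', LinearIsometryEquiv.dist_map]
      rw [dist_comm]
      linarith
    have hy0 := norm_nonneg y
    have h1 : (inner ℝ v y : ℝ) ≤ R + ε * (2 * ‖y‖) := by
      have h2 := (hsep y hy).le.trans hvw
      have h3 : (inner ℝ v ((A ^ (j + 1)) y) : ℝ) ≤ ‖y‖ := by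
        simpa [hvn, LinearIsometryEquiv.norm_map] using real_inner_le_norm v ((A ^ (j + 1)) y)
      have h4 : (1 + t) * (inner ℝ v ((A ^ (j + 1)) y) : ℝ) ≤ 2 * ‖y‖ :=
        (mul_le_mul_of_nonneg_left h3 (by linarith)).trans (by nlinarith)
      have h5 := mul_le_mul_of_nonneg_left h4 hlk.le
      have h6 := mul_le_mul_of_nonneg_right hlkε.le (by linarith : (0 : ℝ) ≤ 2 * ‖y‖)
      linarith
    have h7 : (inner ℝ (u - v) y : ℝ) ≤ 2 * ε * ‖y‖ :=
      (real_inner_le_norm _ _).trans (mul_le_mul_of_nonneg_right hvu hy0)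
    rw [inner_sub_left] at h7
    linarith
  by_contra! hcon
  have h4 : 0 < 4 * ‖y‖ + 1 := by positivity
  have := hkey (((inner ℝ u y : ℝ) - R) / (4 * ‖y‖ + 1)) (div_pos (by linarith) h4)
  rw [div_mul_eq_mul_div, ← sub_le_iff_le_add', le_div_iff₀ h4] at this
  nlinarith

end UniqueNormal

/-! ### Erosion, regular points, and the two implications. -/

section Erosion

variable {n : ℕ} {X : Set (EuclideanSpace ℝ (Fin n))}

theorem mem_erosion_iff {r : ℝ} (hr : 0 < r) {x : EuclideanSpace ℝ (Fin n)} :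
    x ∈ erosion r X ↔ Metric.ball x r ⊆ X := by
  simp only [erosion, Set.mem_sdiff, Set.mem_iUnion, Set.mem_compl_iff, Metric.mem_ball, exists_prop,
    not_exists, not_and]
  constructor
  · intro h y hy
    by_contra hyX
    exact h.2 y hyX (Metric.mem_ball'.1 hy)
  · intro h
    exact ⟨h (Metric.mem_ball_self hr), fun y hy hxy => hy (h (Metric.mem_ball'.2 hxy))⟩

theorem isClosed_erosion (r : ℝ) (hr : 0 < r) : IsClosed (erosion r X) := by
  have : erosion r X = (⋃ y ∈ Xᶜ, Metric.ball y r)ᶜ := by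
    ext x
    simp only [erosion, Set.mem_sdiff, Set.mem_compl_iff, and_iff_right_iff_imp]
    intro h
    by_contra hx
    exact h (Set.mem_biUnion hx (Metric.mem_ball_self hr))
  rw [this]
  exact (isOpen_biUnion fun _ _ => Metric.isOpen_ball).isClosed_compl

theorem isSupportingHalfSpaceAt_of_inner_le {y u : EuclideanSpace ℝ (Fin n)} (hy : y ∈ X)
    (hu : u ≠ 0) (h : ∀ x ∈ X, inner ℝ u x ≤ (inner ℝ u y : ℝ)) :
    IsSupportingHalfSpaceAt X {x | inner ℝ u x ≤ (inner ℝ u y : ℝ)} y := by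
  have hf : y ∈ frontier {x | inner ℝ u x ≤ (inner ℝ u y : ℝ)} := by
    rw [frontier_setOf_inner_le hu]; exact rfl
  exact ⟨⟨u, _, hu, rfl⟩, h, ⟨subset_closure hy, fun hi => hf.2 (interior_mono h hi)⟩, hf⟩

theorem IsSupportingHalfSpaceAt.exists_unit_normal {H : Set (EuclideanSpace ℝ (Fin n))}
    {y : EuclideanSpace ℝ (Fin n)} (h : IsSupportingHalfSpaceAt X H y) :
    ∃ u : EuclideanSpace ℝ (Fin n), ‖u‖ = 1 ∧ H = {x | inner ℝ u x ≤ (inner ℝ u y : ℝ)} ∧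
      ∀ x ∈ X, inner ℝ u x ≤ (inner ℝ u y : ℝ) := by
  obtain ⟨⟨u, c, hu, rfl⟩, hX, -, hy⟩ := h
  rw [frontier_setOf_inner_le hu] at hy
  obtain rfl : inner ℝ u y = c := hy
  have hu0 : 0 < ‖u‖⁻¹ := inv_pos.2 (norm_pos_iff.2 hu)
  have key : {x | inner ℝ u x ≤ (inner ℝ u y : ℝ)} =
      {x | inner ℝ (‖u‖⁻¹ • u) x ≤ (inner ℝ (‖u‖⁻¹ • u) y : ℝ)} := by
    ext x
    simp only [Set.mem_ofPred_eq, real_inner_smul_left, mul_le_mul_iff_right₀ hu0]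
  refine ⟨‖u‖⁻¹ • u, ?_, key, fun x hx => ?_⟩
  · rw [norm_smul, norm_inv, norm_norm, inv_mul_cancel₀ (norm_ne_zero_iff.2 hu)]
  · have := hX hx
    rwa [key] at this

theorem isRegularPoint_of_unique_unit_normal {y u : EuclideanSpace ℝ (Fin n)} (hy : y ∈ X)
    (hu : u ≠ 0) (h : ∀ x ∈ X, inner ℝ u x ≤ (inner ℝ u y : ℝ))
    (huniq : ∀ v : EuclideanSpace ℝ (Fin n), ‖v‖ = 1 →
      (∀ x ∈ X, inner ℝ v x ≤ (inner ℝ v y : ℝ)) → v = u) : IsRegularPoint X y := by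
  have hs := isSupportingHalfSpaceAt_of_inner_le hy hu h
  refine ⟨hs.2.2.1, _, hs, fun H hH => ?_⟩
  obtain ⟨v, hv, rfl, hvX⟩ := hH.exists_unit_normal
  rw [huniq v hv hvX]

theorem IsRegularSupportingHyperplane.exists_unique_unit_normal
    {P : Set (EuclideanSpace ℝ (Fin n))} (hcl : IsClosed X)
    (h : IsRegularSupportingHyperplane X P) :
    ∃ y ∈ X, ∃ u : EuclideanSpace ℝ (Fin n), ‖u‖ = 1 ∧ P = {x | inner ℝ u x = (inner ℝ u y : ℝ)} ∧
      (∀ x ∈ X, inner ℝ u x ≤ (inner ℝ u y : ℝ)) ∧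
      ∀ v : EuclideanSpace ℝ (Fin n), ‖v‖ = 1 →
        (∀ x ∈ X, inner ℝ v x ≤ (inner ℝ v y : ℝ)) → v = u := by
  obtain ⟨H, ⟨y, hreg, hH⟩, rfl⟩ := h
  have hy : y ∈ X := hcl.frontier_subset hreg.1
  obtain ⟨u, hu, rfl, huX⟩ := hH.exists_unit_normal
  have hu0 : u ≠ 0 := fun h => by simp [h] at hu
  refine ⟨y, hy, u, hu, frontier_setOf_inner_le hu0 _, huX, fun v hv hvX => ?_⟩
  have hv0 : v ≠ 0 := fun h => by simp [h] at hv
  have := hreg.2.unique (isSupportingHalfSpaceAt_of_inner_le hy hv0 hvX) hH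
  exact eq_of_halfSpace_subset_halfSpace hv hu this.subset

/-- The regular hyperplane separating `z` is at distance `‖u‖⁻¹` from `c`: at least `R` as the ball
lies in `X`, at most `R` as the ball meets it. -/
theorem IsInscribedBall.exists_separating_unit {c : EuclideanSpace ℝ (Fin n)} {R : ℝ}
    (hcl : IsClosed X) (hcv : Convex ℝ X) (hR : 0 < R) (h : IsInscribedBall X c R)
    {z : EuclideanSpace ℝ (Fin n)} (hz : z ∉ X) :
    ∃ e : EuclideanSpace ℝ (Fin n), ‖e‖ = 1 ∧ (∀ x ∈ X, inner ℝ e (x - c) ≤ R) ∧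
      R < inner ℝ e (z - c) := by
  set Y : Set (EuclideanSpace ℝ (Fin n)) := (fun x => x + c) ⁻¹' X with hY
  have hball : Metric.closedBall 0 R ⊆ Y := fun x hx => h.1 (by
    simpa [Metric.mem_closedBall, dist_eq_norm] using hx)
  have hYcl : IsClosed Y := hcl.preimage (by fun_prop)
  have hYcv : Convex ℝ Y := hcv.translate_preimage_left c
  obtain ⟨y, hy, u, huy, huY, huniq, huz⟩ := exists_unique_normal_separating hYcl hYcv
    (Filter.mem_of_superset (Metric.closedBall_mem_nhds 0 hR) hball) (z := z - c)
    (by simpa [hY] using hz)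
  have hu0 : u ≠ 0 := fun h => by simp [h] at huy
  have hun : 0 < ‖u‖ := norm_pos_iff.2 hu0
  set e := ‖u‖⁻¹ • u with he
  have hen : ‖e‖ = 1 := by rw [he, norm_smul, norm_inv, norm_norm, inv_mul_cancel₀ hun.ne']
  have he0 : e ≠ 0 := fun h => by simp [h] at hen
  have hey : inner ℝ e y = ‖u‖⁻¹ := by rw [he, real_inner_smul_left, huy, mul_one]
  have hle : ∀ x ∈ X, inner ℝ e (x - c) ≤ ‖u‖⁻¹ := fun x hx => by
    rw [he, real_inner_smul_left]
    exact mul_le_of_le_one_right (inv_nonneg.2 hun.le) (huY _ (by simpa [hY] using hx))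
  have hlin : ∀ v x : EuclideanSpace ℝ (Fin n),
      (inner ℝ v (x - c) : ℝ) = inner ℝ v x - inner ℝ v c := fun v x => inner_sub_right _ _ _
  have hlin' : ∀ v : EuclideanSpace ℝ (Fin n),
      (inner ℝ v (y + c) : ℝ) = inner ℝ v y + inner ℝ v c := fun v => inner_add_right _ _ _
  have heX : ∀ x ∈ X, inner ℝ e x ≤ (inner ℝ e (y + c) : ℝ) := fun x hx => by
    have := hle x hx
    rw [hlin] at this
    rw [hlin', hey]
    linarith
  have hreg : IsRegularPoint X (y + c) := by
    refine isRegularPoint_of_unique_unit_normal hy he0 heX fun v hv hvX => ?_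
    have hvY : ∀ x ∈ Y, (inner ℝ v x : ℝ) ≤ inner ℝ v y := fun x hx => by
      have := hvX _ hx
      rw [hlin', inner_add_right] at this
      linarith
    have hvy : 0 < (inner ℝ v y : ℝ) := by
      have := hvY (R • v) (hball (by
        rw [mem_closedBall_zero_iff, norm_smul, hv, mul_one, Real.norm_of_nonneg hR.le]))
      rw [inner_smul_right, real_inner_self_eq_norm_sq, hv] at this
      linarith
    have hvu : (inner ℝ v y : ℝ)⁻¹ • v = u := by
      refine huniq _ ?_ fun x hx => ?_
      · rw [real_inner_smul_left, inv_mul_cancel₀ hvy.ne']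
      · rw [real_inner_smul_left, inv_mul_le_one₀ hvy]
        exact hvY x hx
    rw [he, ← hvu, norm_smul, hv, mul_one, Real.norm_of_nonneg (inv_nonneg.2 hvy.le), inv_inv,
      smul_inv_smul₀ hvy.ne']
  obtain ⟨b, hb, hbP⟩ := h.2 _ ⟨_, ⟨_, hreg, isSupportingHalfSpaceAt_of_inner_le hy he0 heX⟩, rfl⟩
  rw [frontier_setOf_inner_le he0, Set.mem_ofPred_eq, hlin', hey] at hbP
  have h1 : ‖u‖⁻¹ ≤ R := by
    have h2 := real_inner_le_norm e (b - c)
    rw [hen, one_mul, hlin, ← dist_eq_norm] at h2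
    have := Metric.mem_closedBall.1 hb
    linarith
  have h2 : R ≤ ‖u‖⁻¹ := by
    have := hle (R • e + c) (hball (by
        rw [mem_closedBall_zero_iff, norm_smul, hen, mul_one, Real.norm_of_nonneg hR.le]))
    rwa [add_sub_cancel_right, inner_smul_right, real_inner_self_eq_norm_sq, hen, one_pow,
      mul_one] at this
  refine ⟨e, hen, fun x hx => (hle x hx).trans h1, h2.trans_lt ?_⟩
  rw [he, real_inner_smul_left]
  exact lt_mul_of_one_lt_right (inv_pos.2 hun) huz

theorem isResilientTo_of_isInscribedBall {c : EuclideanSpace ℝ (Fin n)} {r R : ℝ} (hr : 0 < r)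
    (hrR : r < R) (hcl : IsClosed X) (hcv : Convex ℝ X) (h : IsInscribedBall X c R) :
    IsResilientTo X r := by
  have hR : 0 < R := hr.trans hrR
  set m : ℝ := (R - r) / R with hm
  have hm0 : 0 < m := div_pos (by linarith) hR
  have hmR : m * R = R - r := div_mul_cancel₀ _ hR.ne'
  have hm1 : m ≤ 1 := by rw [hm, div_le_one hR]; linarith
  refine ⟨(IsometryEquiv.subRight c).toDilationEquiv.trans
    (DilationEquiv.smulTorsor c (k := m) hm0.ne'), ?_⟩
  ext p
  rw [mem_erosion_iff hr]
  constructor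
  · rintro ⟨x, hx, rfl⟩ q hq
    set d := q - (m • (x - c) + c) with hd
    have hdr : ‖d‖ < r := by rw [hd, ← dist_eq_norm]; exact hq
    -- As `1 - m = r / R`, the displacement `d` is the scaled copy of a displacement inside the
    -- inscribed ball.
    have hq' : q = m • x + (1 - m) • (c + (R / r) • d) := by
      have h1 : (1 - m) * (R / r) = 1 := by
        rw [hm]; field_simp; ring
      rw [smul_add, smul_smul, h1, one_smul, hd, smul_sub, sub_smul, one_smul]
      abel
    rw [hq']
    refine hcv hx (h.1 ?_) hm0.le (by linarith) (by ring)
    rw [Metric.mem_closedBall, dist_eq_norm, add_sub_cancel_left, norm_smul,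
      Real.norm_of_nonneg (by positivity), div_mul_eq_mul_div, div_le_iff₀ hr]
    exact mul_le_mul_of_nonneg_left hdr.le hR.le
  · intro hp
    refine ⟨m⁻¹ • (p - c) + c, ?_, ?_⟩
    · by_contra hx
      obtain ⟨e, he, heX, hez⟩ := h.exists_separating_unit hcl hcv hR hx
      have h1 := closure_minimal hp hcl
      rw [closure_ball _ hr.ne'] at h1
      have h2 := heX (p + r • e) (h1 (by
        rw [Metric.mem_closedBall, dist_eq_norm, add_sub_cancel_left, norm_smul, he, mul_one,
          Real.norm_of_nonneg hr.le]))
      rw [add_sub_right_comm, inner_add_right, inner_smul_right, real_inner_self_eq_norm_sq, he,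
        one_pow, mul_one] at h2
      rw [add_sub_cancel_right, inner_smul_right, lt_inv_mul_iff₀ hm0, hmR] at hez
      linarith
    · change m • (m⁻¹ • (p - c) + c - c) + c = p
      rw [add_sub_cancel_right, smul_inv_smul₀ hm0.ne', sub_add_cancel]

/-- The balls about `σ a` and `σ b` let both points move apart by `r / 2` within `X`, so ratio times
diameter plus `r` is at most the diameter. -/
theorem ratio_lt_one_of_image_eq_erosion [Nontrivial (EuclideanSpace ℝ (Fin n))] {r : ℝ}
    (hr : 0 < r) (hb : Bornology.IsBounded X) (hne : X.Nonempty)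
    {σ : EuclideanSpace ℝ (Fin n) ≃ᵈ EuclideanSpace ℝ (Fin n)} (hσ : σ '' X = erosion r X) :
    Dilation.ratio σ < 1 := by
  have hl : (0 : ℝ) < Dilation.ratio σ := Dilation.ratio_pos σ
  have hkey : ∀ a ∈ X, ∀ b ∈ X, Dilation.ratio σ * dist a b + r ≤ Metric.diam X := by
    intro a ha b hb'
    rw [← Dilation.dist_eq]
    have hpa : Metric.ball (σ a) r ⊆ X := (mem_erosion_iff hr).1 (hσ ▸ Set.mem_image_of_mem σ ha)
    have hpb : Metric.ball (σ b) r ⊆ X := (mem_erosion_iff hr).1 (hσ ▸ Set.mem_image_of_mem σ hb')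
    obtain ⟨e, he, hpq⟩ : ∃ e : EuclideanSpace ℝ (Fin n), ‖e‖ = 1 ∧
        σ a - σ b = ‖σ a - σ b‖ • e := by
      by_cases h : σ a - σ b = 0
      · obtain ⟨e, he⟩ := exists_norm_eq (EuclideanSpace ℝ (Fin n)) zero_le_one
        exact ⟨e, he, by rw [h, norm_zero, zero_smul]⟩
      · refine ⟨‖σ a - σ b‖⁻¹ • (σ a - σ b), ?_, ?_⟩
        · rw [norm_smul, norm_inv, norm_norm, inv_mul_cancel₀ (norm_ne_zero_iff.2 h)]
        · rw [smul_inv_smul₀ (norm_ne_zero_iff.2 h)]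
    have hr2 : 0 ≤ r / 2 := by linarith
    have h1 : σ a + (r / 2) • e ∈ X := hpa (by
      rw [Metric.mem_ball, dist_eq_norm, add_sub_cancel_left, norm_smul, he,
        Real.norm_of_nonneg hr2]
      linarith)
    have h2 : σ b - (r / 2) • e ∈ X := hpb (by
      rw [Metric.mem_ball, dist_eq_norm, sub_sub_cancel_left, norm_neg, norm_smul, he,
        Real.norm_of_nonneg hr2]
      linarith)
    have h3 := Metric.dist_le_diam_of_mem hb h1 h2
    have h4 : σ a + (r / 2) • e - (σ b - (r / 2) • e) = (‖σ a - σ b‖ + r) • e := by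
      rw [add_smul, ← hpq, show r • e = (r / 2) • e + (r / 2) • e by rw [← add_smul, add_halves]]
      abel
    rwa [dist_eq_norm, h4, norm_smul, he, mul_one, Real.norm_of_nonneg (by positivity),
      ← dist_eq_norm] at h3
  obtain ⟨x, hx⟩ := hne
  have h0 := hkey x hx x hx
  rw [dist_self, mul_zero, zero_add] at h0
  have h1 : Metric.diam X ≤ (Metric.diam X - r) / Dilation.ratio σ := by
    refine Metric.diam_le_of_forall_dist_le (div_nonneg (by linarith) hl.le) fun a ha b hb' => ?_
    rw [le_div_iff₀' hl]
    linarith [hkey a ha b hb']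
  rw [le_div_iff₀ hl] at h1
  have h2 : (Dilation.ratio σ : ℝ) < 1 := by
    by_contra! h
    nlinarith
  exact_mod_cast h2

theorem isConvexBody_and_exists_isInscribedBall [Nontrivial (EuclideanSpace ℝ (Fin n))] {r : ℝ}
    (hr : 0 < r) (hb : Bornology.IsBounded X) (hne : X.Nonempty) (h : IsResilientTo X r) :
    IsConvexBody X ∧
      ∃ (c : EuclideanSpace ℝ (Fin n)) (R : ℝ), r < R ∧ IsInscribedBall X c R := by
  obtain ⟨σ, hσ⟩ := h
  have hl1' := ratio_lt_one_of_image_eq_erosion hr hb hne hσ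
  have hcontr : ContractingWith (Dilation.ratio σ) σ := ⟨hl1', Dilation.lipschitz σ⟩
  obtain ⟨c, hc⟩ : ∃ c, σ c = c := ⟨_, hcontr.fixedPoint_isFixedPt⟩
  set l : ℝ := (Dilation.ratio σ : ℝ) with hl
  have hl0 : 0 < l := Dilation.ratio_pos σ
  have hl1 : l < 1 := by exact_mod_cast hl1'
  have hcl : IsClosed X := by
    have := σ.toHomeomorph.isClosed_image (s := X)
    rw [← this]
    exact (congrArg IsClosed hσ).mpr (isClosed_erosion r hr)
  -- `σ` recentred at its fixed point and divided by its ratio: an isometry fixing 0, hence linear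
  -- by Mazur–Ulam.
  let f : EuclideanSpace ℝ (Fin n) ≃ᵢ EuclideanSpace ℝ (Fin n) :=
    IsometryEquiv.mk' (fun x => l⁻¹ • (σ (x + c) - c)) (fun x => σ.symm (l • x + c) - c)
      (fun x => by simp [inv_smul_smul₀ hl0.ne'])
      (Isometry.of_dist_eq fun x y => by
        rw [dist_smul₀, dist_sub_right, Dilation.dist_eq, dist_add_right, ← hl,
          Real.norm_of_nonneg (inv_nonneg.2 hl0.le), inv_mul_cancel_left₀ hl0.ne'])
  have hf0 : f 0 = 0 := by
    change l⁻¹ • (σ (0 + c) - c) = 0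
    rw [zero_add, hc, sub_self, smul_zero]
  set A := f.toRealLinearIsometryEquivOfMapZero hf0 with hA
  have hσA : ∀ x, l • A x + c = σ (x + c) := by
    intro x
    change l • (l⁻¹ • (σ (x + c) - c)) + c = _
    rw [smul_inv_smul₀ hl0.ne', sub_add_cancel]
  set R := r / (1 - l) with hR
  have h1l : 0 < 1 - l := by linarith
  have hR0 : 0 < R := div_pos hr h1l
  have hRr : R * (1 - l) = r := div_mul_cancel₀ _ h1l.ne'
  set Y : Set (EuclideanSpace ℝ (Fin n)) := (fun x => x + c) ⁻¹' X with hY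
  have hYX : ∀ x, x ∈ Y ↔ Metric.ball (l • A x) (R * (1 - l)) ⊆ Y := by
    intro x
    rw [hRr]
    change x + c ∈ X ↔ _
    rw [← σ.injective.mem_set_image, hσ, mem_erosion_iff hr, ← hσA]
    constructor
    · intro h y hy
      exact h (by simpa using hy)
    · intro h y hy
      have := h (show y - c ∈ _ by
        rw [Metric.mem_ball, dist_eq_norm] at hy ⊢
        rwa [sub_sub, add_comm c])
      simpa [hY] using this
  have hYcl : IsClosed Y := hcl.preimage (by fun_prop)
  have hYne : Y.Nonempty := by
    obtain ⟨x, hx⟩ := hne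
    exact ⟨x - c, by simpa [hY] using hx⟩
  have hYb : Bornology.IsBounded Y := by
    obtain ⟨D, hD⟩ := hb.subset_closedBall c
    refine Metric.isBounded_closedBall (x := 0) (r := D) |>.subset fun x hx => ?_
    simpa [dist_eq_norm] using hD hx
  have hY0 := zero_mem_of_mem_iff_ball_subset hl0 hl1 hR0 hYne hYcl hYX
  have hball := closedBall_subset_of_mem_iff_ball_subset hl0 hl1 hR0 hYcl hY0 hYX
  have hYcv : Convex ℝ Y := convex_of_exists_ball_disjoint hYcl hYb
    (Filter.mem_of_superset (Metric.closedBall_mem_nhds 0 hR0) hball)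
    fun z hz M => exists_ball_disjoint hl0 hl1 hR0 hYX hz M
  have hXcv : Convex ℝ X := by
    have := hYcv.translate_preimage_left (-c)
    have hXY : (fun x => x + -c) ⁻¹' Y = X := by
      ext x; simp [hY]
    rwa [hXY] at this
  refine ⟨⟨hcl, hXcv⟩, c, R, ?_, ?_, fun P hP => ?_⟩
  · rw [hR, lt_div_iff₀ h1l]
    nlinarith
  · intro x hx
    have := hball (show x - c ∈ _ by simpa [dist_eq_norm] using hx)
    simpa [hY] using this
  · obtain ⟨y, hy, u, hu, rfl, huX, huniq⟩ := hP.exists_unique_unit_normal hcl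
    have hy' : y - c ∈ Y := by simpa [hY] using hy
    have hiff : ∀ v : EuclideanSpace ℝ (Fin n),
        (∀ x ∈ Y, inner ℝ v x ≤ (inner ℝ v (y - c) : ℝ)) ↔
          ∀ x ∈ X, inner ℝ v x ≤ (inner ℝ v y : ℝ) := by
      intro v
      constructor
      · intro h x hx
        have := h (x - c) (by simpa [hY] using hx)
        simp only [inner_sub_right] at this
        linarith
      · intro h x hx
        have := h (x + c) hx
        simp only [inner_add_right] at this
        rw [inner_sub_right]
        linarith
    have hle := inner_le_of_unique_normal hl0 hl1 hR0 hYcl hYcv hball hYX hy' hu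
      ((hiff u).2 huX) fun v hv hvY => huniq v hv ((hiff v).1 hvY)
    have huu : (inner ℝ u u : ℝ) = 1 := by rw [real_inner_self_eq_norm_sq, hu, one_pow]
    have hge : R ≤ inner ℝ u (y - c) := by
      have := (hiff u).2 huX (R • u) (hball (by
        rw [mem_closedBall_zero_iff, norm_smul, hu, mul_one, Real.norm_of_nonneg hR0.le]))
      rwa [inner_smul_right, huu, mul_one] at this
    -- `hle` and `hge` place the hyperplane at distance exactly `R`, so it touches the ball here.
    refine ⟨c + R • u, ?_, ?_⟩
    · rw [Metric.mem_closedBall, dist_eq_norm, add_sub_cancel_left, norm_smul, hu, mul_one,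
        Real.norm_of_nonneg hR0.le]
    · rw [inner_sub_right] at hle hge
      rw [Set.mem_ofPred_eq, inner_add_right, inner_smul_right, huu]
      linarith

end Erosion

theorem theorem1 (n : ℕ) (X : Set (EuclideanSpace ℝ (Fin n))) (hne : X.Nonempty)
    (hb : Bornology.IsBounded X) (r : ℝ) (hr : 0 < r) :
    IsResilientTo X r ↔
      IsConvexBody X ∧
        ∃ (c : EuclideanSpace ℝ (Fin n)) (R : ℝ), r < R ∧ IsInscribedBall X c R := by
  constructor
  · intro h
    rcases subsingleton_or_nontrivial (EuclideanSpace ℝ (Fin n)) with hs | hs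
    -- In dimension 0 the frontier is empty, so any radius above `r` is inscribed.
    · obtain rfl : X = Set.univ := Subsingleton.eq_univ_of_nonempty hne
      refine ⟨⟨isClosed_univ, convex_univ⟩, 0, r + 1, by linarith, Set.subset_univ _, ?_⟩
      rintro P ⟨H, ⟨x, hx, -⟩, -⟩
      simpa using hx.1
    · exact isConvexBody_and_exists_isInscribedBall hr hb hne h
  · rintro ⟨⟨hcl, hcv⟩, c, R, hrR, h⟩
    exact isResilientTo_of_isInscribedBall hr hrR hcl hcv h
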